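/- Let $F_N$ be the free group on a basis $A_N$ with $N\ge 2$ elements, let $\partial F_N$ be its Gromov boundary (infinite reduced words in $A_N^{\pm1}$), and let $F_N\cup\partial F_N$ be the usual compactification. For an automorphism $\psi$ of $F_N$, $\partial\psi$ is the induced homeomorphism of $\partial F_N$. Put $i_w(u)=w^{-1}uw$. Let $\varphi$ be an automorphism of $F_N$ that is $A_N$-positive (each $\varphi(a)$, $a\in A_N$, is a nonempty word with all letters in $A_N$) and primitive (for some $k\ge1$, all letters of $A_N$ occur in $\varphi^k(a)$ for every $a\in A_N$). Choose a letter $a\in A_N$ and $k\ge 1$ with $\varphi^k(a)=p\,a\,s$, where $p,s$ are nonempty words with all letters in $A_N$, and set $$U=\lim_{n\to\infty}p^{-1}\varphi^k(p^{-1})\cdots\varphi^{nk}(p^{-1}),\qquad V=\lim_{n\to\infty}a\,s\,\varphi^k(s)\cdots\varphi^{nk}(s).$$ The attracting subshift $\Sigma_\varphi\subset\partial^2F_N=(\partial F_N\times\partial F_N)\setminus\Delta$ (where $\Delta$ is the diagonal) is the closure of the two-sided orbit of $(U,V)$ under the shift $S(X,Y)=(Y_0^{-1}X,Y_0^{-1}Y)$,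 where $Y_0$ is the first letter of $Y$ and, along this orbit, $S^{-1}(X,Y)=(X_0^{-1}X,X_0^{-1}Y)$; it does not depend on the choices. With $\Sigma_\varphi^-$ and $\Sigma_\varphi^+$ its first and second projections, the half lamination is $L(\varphi)=F_N\cdot(\Sigma_\varphi^-\cup\Sigma_\varphi^+)$. 1. Let $w\in F_N$ and $\psi=i_w\circ\varphi$, and suppose that $X\in\partial F_N\setminus L(\varphi)$ is attracting for $\partial\psi$, that is, $X$ has a neighbourhood $\mathcal U$ in $\partial F_N$ such that $(\partial\psi)^n(Y)\to X$ for all $Y\in\mathcal U$. Then $w\neq\epsilon$, where $\epsilon$ is the empty word, and $$X=\lim_{n\to\infty}w^{-1}\varphi(w^{-1})\cdots\varphi^n(w^{-1}).$$ 2. Call $X\in\partial F_N$ an attracting point of $\partial\psi$ in the compactification if $X$ has a neighbourhood $\mathcal U$ in $F_N\cup\partial F_N$ such that the iterates of every $Y\in\mathcal U$ under $\psi\cup\partial\psi$ converge to $X$. Let $a(\psi)$ be the number of orbits of $\mathrm{Fix}(\psi)=\{u\in F_N : \psi(u)=u\}$ on the set of these attracting points, and let $\mathrm{ind}(\psi)=\mathrm{rk}(\mathrm{Fix}(\psi))+\frac12(a(\psi)-2)$.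 If $\psi=i_w\circ\varphi^k$ with $w\in F_N$ and $k\ge1$, and $\partial\psi$ has an attracting point in the compactification that lies outside $L(\varphi)$, then $\mathrm{ind}(\psi)=-\frac12$. -/

import Mathlib

open Filter Topology

namespace FreeBoundary

/-! ### The boundary of the free group with basis `Fin N` and its compactification -/

/-- The Gromov boundary of the free group: infinite reduced words. The letter `(a, true)` is the
basis element `a`, the letter `(a, false)` is its inverse. -/
def Boundary (N : ℕ) : Type :=
  {X : ℕ → Fin N × Bool // ∀ i, (X i).1 = (X (i + 1)).1 → (X i).2 = (X (i + 1)).2}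

/-- Product topology of the discrete topologies. -/
instance (N : ℕ) : TopologicalSpace (Boundary N) :=
  TopologicalSpace.induced (fun X => X.1) inferInstance

/-- The compactification of the free group by its boundary: finite and infinite reduced words. -/
inductive Compactification (N : ℕ) : Type
  | word (g : FreeGroup (Fin N)) : Compactification N
  | point (X : Boundary N) : Compactification N

open Compactification

/-- The `i`-th letter of a finite or infinite reduced word, if there is one. -/
def Compactification.letter {N : ℕ} : Compactification N → ℕ → Option (Fin N × Bool)
  | word g, i => g.toWord[i]?
  | point X, i => some (X.1 i)

/-- Letterwise convergence: the coarsest topology such that each `Y ↦ letter Y i` is continuous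
to a discrete space. -/
instance (N : ℕ) : TopologicalSpace (Compactification N) :=
  TopologicalSpace.induced Compactification.letter
    (@Pi.topologicalSpace ℕ (fun _ => Option (Fin N × Bool)) (fun _ => ⊥))

/-- The prefix of length `n` of an infinite reduced word. -/
def Boundary.take {N : ℕ} (X : Boundary N) (n : ℕ) : FreeGroup (Fin N) :=
  FreeGroup.mk ((List.range n).map X.1)

theorem tendsto_word_iff {N : ℕ} (g : ℕ → FreeGroup (Fin N)) (Y : Boundary N) :
    Tendsto (fun n => word (g n)) atTop (𝓝 (point Y)) ↔
      ∀ i, ∀ᶠ n in atTop, (g n).toWord[i]? = some (Y.1 i) := by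
  let _ : TopologicalSpace (Option (Fin N × Bool)) := ⊥
  have : DiscreteTopology (Option (Fin N × Bool)) := ⟨rfl⟩
  rw [nhds_induced, tendsto_comap_iff, tendsto_pi_nhds]
  refine forall_congr' fun i => ?_
  rw [nhds_discrete, tendsto_pure]
  rfl

theorem toWord_take {N : ℕ} (X : Boundary N) (n : ℕ) :
    (X.take n).toWord = (List.range n).map X.1 := by
  rw [Boundary.take, FreeGroup.toWord_mk]
  apply FreeGroup.IsReduced.reduce_eq
  rw [FreeGroup.IsReduced, List.isChain_iff_getElem]
  intro i hi
  simpa using X.2 i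

theorem take_succ {N : ℕ} (X : Boundary N) (n : ℕ) :
    X.take (n + 1) = X.take n * FreeGroup.mk [X.1 n] := by
  simp [Boundary.take, List.range_succ, FreeGroup.mul_mk]

theorem take_injective {N : ℕ} (X : Boundary N) : Function.Injective X.take := by
  intro m n h
  simpa [toWord_take] using congrArg (fun g => g.toWord.length) h

theorem take_prefix_reduce {N : ℕ} (L₂ : List (Fin N × Bool)) :
    ∀ L₁ : List (Fin N × Bool), FreeGroup.IsReduced L₁ →
      L₁.take (L₁.length - L₂.length) <+: FreeGroup.reduce (L₁ ++ L₂) := by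
  induction L₂ with
  | nil => intro L₁ h; simp [h.reduce_eq]
  | cons l L ih =>
    intro L₁ h
    by_cases hr : FreeGroup.IsReduced (L₁ ++ [l])
    · have h1 := ih _ hr
      rw [List.append_assoc, List.singleton_append] at h1
      refine List.IsPrefix.trans ?_ h1
      have h2 : (L₁ ++ [l]).take ((L₁ ++ [l]).length - L.length) =
          (L₁ ++ [l]).take (L₁.length + 1 - L.length) := by simp
      rw [h2]
      have h3 : L₁.take (L₁.length - (l :: L).length) =
          (L₁ ++ [l]).take (L₁.length - (l :: L).length) := by
        rw [List.take_append_of_le_length (by omega)]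
      rw [h3]
      exact List.take_prefix_take_left (by simp; omega)
    · rcases List.eq_nil_or_concat' L₁ with rfl | ⟨L', c, rfl⟩
      · simp
      · have hc : c.1 = l.1 ∧ c.2 = !l.2 := by
          by_contra hcon
          apply hr
          rw [FreeGroup.IsReduced, List.isChain_append]
          refine ⟨h, by simp, ?_⟩
          intro x hx y hy
          simp at hx hy
          subst hx hy
          grind
        have hred : FreeGroup.reduce (L' ++ [c] ++ l :: L) = FreeGroup.reduce (L' ++ L) := by
          apply FreeGroup.reduce.Step.eq
          obtain ⟨c1, c2⟩ := c
          obtain ⟨l1, l2⟩ := l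
          simp only at hc
          obtain ⟨rfl, rfl⟩ := hc
          simpa using FreeGroup.Red.Step.not (L₁ := L') (L₂ := L) (x := c1) (b := !l2)
        rw [hred]
        have h' : FreeGroup.IsReduced L' := by
          rw [FreeGroup.IsReduced, List.isChain_append] at h
          exact h.1
        have h2 := ih L' h'
        rw [List.take_append_of_le_length (by simp)]
        simpa using h2

theorem getElem?_toWord_mul {N : ℕ} (x z : FreeGroup (Fin N)) (i : ℕ)
    (h : i + z.norm < x.norm) : (x * z).toWord[i]? = x.toWord[i]? := by
  obtain ⟨t, ht⟩ := take_prefix_reduce z.toWord x.toWord FreeGroup.isReduced_toWord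
  rw [FreeGroup.toWord_mul, ← ht]
  rw [FreeGroup.norm, FreeGroup.norm] at h
  rw [List.getElem?_append_left (by simp; omega), List.getElem?_take_of_lt (by omega)]

/-- An injective sequence of group elements with bounded steps converges to a boundary point. -/
theorem exists_tendsto {N : ℕ} (g : ℕ → FreeGroup (Fin N)) (hg : Function.Injective g) (C : ℕ)
    (hC : ∀ n, ((g n)⁻¹ * g (n + 1)).norm ≤ C) :
    ∃ Y : Boundary N, Tendsto (fun n => word (g n)) atTop (𝓝 (point Y)) := by
  have hfin : ∀ K : ℕ, {x : FreeGroup (Fin N) | x.norm ≤ K}.Finite := fun K =>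
    Set.Finite.preimage (FreeGroup.toWord_injective.injOn)
      (List.finite_length_le (Fin N × Bool) K)
  have hlarge : ∀ K : ℕ, ∃ n₀, ∀ n ≥ n₀, K < (g n).norm := by
    intro K
    have := hg.tendsto_cofinite.eventually (hfin K).compl_mem_cofinite
    rw [Nat.cofinite_eq_atTop, eventually_atTop] at this
    obtain ⟨n₀, h⟩ := this
    exact ⟨n₀, fun n hn => by simpa using h n hn⟩
  have hst : ∀ i : ℕ, ∃ c, ∃ n₀, ∀ n ≥ n₀, (g n).toWord[i]? = some c := by
    intro i
    obtain ⟨n₀, h₀⟩ := hlarge (i + C)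
    have hlen : i < (g n₀).toWord.length := by
      have := h₀ n₀ le_rfl
      rw [FreeGroup.norm] at this
      omega
    refine ⟨(g n₀).toWord[i], n₀, fun n hn => ?_⟩
    induction n, hn using Nat.le_induction with
    | base => simp
    | succ n hn ih =>
      rw [← ih]
      have := getElem?_toWord_mul (g n) ((g n)⁻¹ * g (n + 1)) i
        (by have := h₀ n hn; have := hC n; omega)
      simpa using this
  choose c m hm using hst
  refine ⟨⟨c, fun i => ?_⟩, (tendsto_word_iff _ _).2 fun i =>
    eventually_atTop.2 ⟨m i, hm i⟩⟩
  have h1 := hm i (max (m i) (m (i + 1))) (le_max_left _ _)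
  have h2 := hm (i + 1) (max (m i) (m (i + 1))) (le_max_right _ _)
  have hred := FreeGroup.isReduced_toWord (x := g (max (m i) (m (i + 1))))
  rw [FreeGroup.IsReduced, List.isChain_iff_getElem] at hred
  obtain ⟨h1', h1⟩ := List.getElem?_eq_some_iff.1 h1
  obtain ⟨h2', h2⟩ := List.getElem?_eq_some_iff.1 h2
  have := hred i h2'
  rwa [h1, h2] at this

theorem exists_tendsto_map {N : ℕ} (φ : MulAut (FreeGroup (Fin N))) (X : Boundary N) :
    ∃ Y : Boundary N, Tendsto (fun n => word (φ (X.take n))) atTop (𝓝 (point Y)) := by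
  obtain ⟨C, hC⟩ := (Set.finite_range
    fun l : Fin N × Bool => (φ (FreeGroup.mk [l])).norm).bddAbove
  refine exists_tendsto _ (φ.injective.comp (take_injective X)) C fun n => ?_
  have : (φ (X.take n))⁻¹ * φ (X.take (n + 1)) = φ (FreeGroup.mk [X.1 n]) := by
    rw [take_succ, map_mul, inv_mul_cancel_left]
  exact this ▸ hC ⟨X.1 n, rfl⟩

theorem exists_tendsto_mul {N : ℕ} (v : FreeGroup (Fin N)) (X : Boundary N) :
    ∃ Y : Boundary N, Tendsto (fun n => word (v * X.take n)) atTop (𝓝 (point Y)) := by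
  refine exists_tendsto _ ((mul_right_injective v).comp (take_injective X)) 1 fun n => ?_
  have : (v * X.take n)⁻¹ * (v * X.take (n + 1)) = FreeGroup.mk [X.1 n] := by
    rw [take_succ]; group
  exact this ▸ FreeGroup.norm_mk_le

/-- The map `∂φ` on the boundary: `∂φ(X)` is the limit of the images of the prefixes of `X`. -/
noncomputable def boundaryMap {N : ℕ} (φ : MulAut (FreeGroup (Fin N))) (X : Boundary N) :
    Boundary N :=
  (exists_tendsto_map φ X).choose

/-- Left translation: `v • X` is the limit of `v` times the prefixes of `X`. -/
noncomputable instance (N : ℕ) : SMul (FreeGroup (Fin N)) (Boundary N) where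
  smul v X := (exists_tendsto_mul v X).choose

/-- `φ` on words together with `∂φ` on boundary points. -/
noncomputable def extendedMap {N : ℕ} (φ : MulAut (FreeGroup (Fin N))) :
    Compactification N → Compactification N
  | word g => word (φ g)
  | point X => point (boundaryMap φ X)

/-! ### Positive primitive automorphisms and the attracting subshift -/

/-- Nonempty, and all letters are in the basis (not inverses). -/
def PurePositive {N : ℕ} (v : FreeGroup (Fin N)) : Prop :=
  v ≠ 1 ∧ ∀ l ∈ v.toWord, l.2 = true

/-- The automorphism is positive with respect to the basis. -/
def IsPositive {N : ℕ} (φ : MulAut (FreeGroup (Fin N))) : Prop :=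
  ∀ a, PurePositive (φ (FreeGroup.of a))

/-- For some `k ≥ 1`, every basis letter occurs in every `φ ^ k (a)`. -/
def IsPrimitive {N : ℕ} (φ : MulAut (FreeGroup (Fin N))) : Prop :=
  ∃ k : ℕ, 1 ≤ k ∧ ∀ a b : Fin N, (b, true) ∈ ((φ ^ k) (FreeGroup.of a)).toWord

/-- `g φ(g) φ²(g) ⋯ φⁿ(g)`. -/
def iterProd {N : ℕ} (φ : MulAut (FreeGroup (Fin N))) (g : FreeGroup (Fin N)) (n : ℕ) :
    FreeGroup (Fin N) :=
  ((List.range (n + 1)).map fun i => (φ ^ i) g).prod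

/-- The first letter of a boundary point, as a group element. -/
def Boundary.head {N : ℕ} (X : Boundary N) : FreeGroup (Fin N) :=
  FreeGroup.mk [X.1 0]

/-- The shift map `(X, Y) ↦ (Y₀⁻¹ X, Y₀⁻¹ Y)`. -/
noncomputable def shift {N : ℕ} (Z : Boundary N × Boundary N) : Boundary N × Boundary N :=
  (Z.2.head⁻¹ • Z.1, Z.2.head⁻¹ • Z.2)

/-- The inverse shift `(X, Y) ↦ (X₀⁻¹ X, X₀⁻¹ Y)`; it inverts `shift` on pairs whose first letters
differ, in particular on pairs consisting of a negative and a positive point. -/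
noncomputable def shiftInv {N : ℕ} (Z : Boundary N × Boundary N) : Boundary N × Boundary N :=
  (Z.1.head⁻¹ • Z.1, Z.1.head⁻¹ • Z.2)

/-- The two-sided orbit of a pair under the shift. -/
def shiftOrbit {N : ℕ} (Z : Boundary N × Boundary N) : Set (Boundary N × Boundary N) :=
  {W | ∃ n : ℕ, W = shift^[n] Z ∨ W = shiftInv^[n] Z}

/-- The double boundary: the complement of the diagonal. -/
def doubleBoundary (N : ℕ) : Set (Boundary N × Boundary N) :=
  {Z | Z.1 ≠ Z.2}

/-- `Z = (X, Y)` with `X = lim p⁻¹ φᵏ(p⁻¹) ⋯ φⁿᵏ(p⁻¹)` and `Y = lim a s φᵏ(s) ⋯ φⁿᵏ(s)` for some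
letter `a` and some decomposition `φᵏ(a) = p a s`, with `p` and `s` nonempty and positive. -/
def IsGeneratingPair {N : ℕ} (φ : MulAut (FreeGroup (Fin N))) (Z : Boundary N × Boundary N) :
    Prop :=
  ∃ (a : Fin N) (k : ℕ) (p s : FreeGroup (Fin N)), PurePositive p ∧ PurePositive s ∧
    (φ ^ k) (FreeGroup.of a) = p * FreeGroup.of a * s ∧
    Tendsto (fun n => word (iterProd (φ ^ k) p⁻¹ n)) atTop (𝓝 (point Z.1)) ∧
    Tendsto (fun n => word (FreeGroup.of a * iterProd (φ ^ k) s n)) atTop (𝓝 (point Z.2))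

/-- `A` is the attracting subshift of `φ`: the closure, in the double boundary, of the shift orbit
of a generating pair (the result does not depend on the pair). -/
def IsAttractingSubshift {N : ℕ} (φ : MulAut (FreeGroup (Fin N)))
    (A : Set (Boundary N × Boundary N)) : Prop :=
  ∃ Z, IsGeneratingPair φ Z ∧ A = closure (shiftOrbit Z) ∩ doubleBoundary N

/-- All translates of the coordinates of the points of `A`; for the attracting subshift `A` of `φ`,
this is the half lamination of `φ`. -/
def halfLamination {N : ℕ} (A : Set (Boundary N × Boundary N)) : Set (Boundary N) :=
  {X | ∃ v : FreeGroup (Fin N), ∃ V ∈ Prod.fst '' A ∪ Prod.snd '' A, X = v • V}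

/-! ### Attracting points and the index -/

/-- `X` attracts all points of a neighbourhood in the boundary. -/
def IsBoundaryAttracting {N : ℕ} (ψ : MulAut (FreeGroup (Fin N))) (X : Boundary N) : Prop :=
  ∃ U ∈ 𝓝 X, ∀ Y ∈ U, Tendsto (fun n => (boundaryMap ψ)^[n] Y) atTop (𝓝 X)

/-- `X` attracts all (finite and infinite) words of a neighbourhood in the compactification. -/
def IsAttracting {N : ℕ} (ψ : MulAut (FreeGroup (Fin N))) (X : Boundary N) : Prop :=
  ∃ U ∈ 𝓝 (point X), ∀ Y ∈ U, Tendsto (fun n => (extendedMap ψ)^[n] Y) atTop (𝓝 (point X))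

/-- The conjugacy `i_w : u ↦ w⁻¹ u w`. -/
def conjugacy {N : ℕ} (w : FreeGroup (Fin N)) : MulAut (FreeGroup (Fin N)) :=
  MulAut.conj w⁻¹

/-- The automorphisms `i_w ∘ φᵏ` with `k ≥ 1`. -/
def outerPowers {N : ℕ} (φ : MulAut (FreeGroup (Fin N))) : Set (MulAut (FreeGroup (Fin N))) :=
  {ψ | ∃ k : ℕ, 1 ≤ k ∧ ∃ w : FreeGroup (Fin N), ψ = conjugacy w * φ ^ k}

/-- The fixed subgroup. -/
def fixedSubgroup {N : ℕ} (ψ : MulAut (FreeGroup (Fin N))) : Subgroup (FreeGroup (Fin N)) where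
  carrier := {u | ψ u = u}
  mul_mem' := by
    intro a b ha hb
    simp only [Set.mem_ofPred_eq] at *
    rw [map_mul, ha, hb]
  one_mem' := map_one ψ
  inv_mem' := by
    intro a ha
    simp only [Set.mem_ofPred_eq] at *
    rw [map_inv, ha]

/-- The rank of a subgroup: the least number of generators. -/
noncomputable def subgroupRank {G : Type*} [Group G] (H : Subgroup G) : ℕ∞ :=
  ⨅ S : {S : Set G // Subgroup.closure S = H}, S.1.encard

/-- The number of orbits of the fixed subgroup on the set of attracting points. -/
noncomputable def numAttracting {N : ℕ} (ψ : MulAut (FreeGroup (Fin N))) : ℕ∞ :=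
  {O : Set (Boundary N) | ∃ X, IsAttracting ψ X ∧
    O = {Y | ∃ u ∈ fixedSubgroup ψ, Y = u • X}}.encard

/-- The index `rk (Fix ψ) + (a(ψ) - 2) / 2`. -/
noncomputable def index {N : ℕ} (ψ : MulAut (FreeGroup (Fin N))) : EReal :=
  ((subgroupRank (fixedSubgroup ψ) : ENNReal) : EReal) +
    ((1 / 2 : ℝ) : EReal) * (((numAttracting ψ : ENNReal) : EReal) - 2)

end FreeBoundary

/-!
Let `ψ = i_w ∘ φᵏ`. The map `τ(u) = w⁻¹ φᵏ(u)` of the free group differs from `ψ` by a right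
translation, so it induces the same map on the boundary; on the Cayley graph it maps every edge to
a path labelled by a legal word, that is, by a factor of some `φⁿ(a)^{±1}`.

The key is `tendsto_of_isLegal`: if `v n → X` with `X` outside the half lamination, and the words
`u n⁻¹ v n` are legal, then `u n → X`. Otherwise the legal paths from `u n` to `v n` run along
longer and longer pieces of a tail of `X`, all of whose factors are then legal. Such a tail is a
coordinate of a point of the attracting subshift (`IsLegalRay.mem_halfLamination`): a generating
pair contains all legal words by primitivity, and compactness of the boundary provides the other
coordinate.

Now let `X` be attracting outside the half lamination. Near `X` there is a boundary point ending in
a legal ray; its `τ`-orbit converges to `X`, hence so does that of the starting point of the ray.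
By the key lemma, convergence of `τⁿ(u)` to `X` passes to the neighbours of `u` in the Cayley graph,
so it holds for all `u` (`IsBoundaryAttracting.tendsto_drift`). The case `u = 1` is the first
statement.

For the second statement, applying the key lemma to a legal ray near another attracting point `Y`
gives `Y = X`. If `ψ(u) = u`, then `τⁿ(u) = u τⁿ(1)`, so `u X = X`; for `u ≠ 1` this makes `X` the
limit of powers of `u` or of `u⁻¹`, which are fixed by `ψ` and so are not attracted by `X`. Hence
the fixed subgroup is trivial, there is a single attracting point, and the index is `0 + (1 - 2)/2`.
-/

namespace FreeBoundary

open Compactification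

variable {N : ℕ}

/-! ### Convergence of words and boundary points -/

theorem toWord_mk_of_isReduced {l : List (Fin N × Bool)} (h : FreeGroup.IsReduced l) :
    (FreeGroup.mk l).toWord = l := by
  rw [FreeGroup.toWord_mk, h.reduce_eq]

theorem boundary_ext {X Y : Boundary N} (h : ∀ i, X.1 i = Y.1 i) : X = Y :=
  Subtype.ext (funext h)

theorem tendsto_word_unique {g : ℕ → FreeGroup (Fin N)} {X Y : Boundary N}
    (hX : Tendsto (fun n => word (g n)) atTop (𝓝 (point X)))
    (hY : Tendsto (fun n => word (g n)) atTop (𝓝 (point Y))) : X = Y := by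
  rw [tendsto_word_iff] at hX hY
  refine boundary_ext fun i => ?_
  obtain ⟨n, h1, h2⟩ := ((hX i).and (hY i)).exists
  rw [h1] at h2
  exact Option.some_injective _ h2

theorem tendsto_boundary_iff (Y : ℕ → Boundary N) (X : Boundary N) :
    Tendsto Y atTop (𝓝 X) ↔ ∀ i, ∀ᶠ n in atTop, (Y n).1 i = X.1 i := by
  rw [nhds_induced, tendsto_comap_iff, tendsto_pi_nhds]
  refine forall_congr' fun i => ?_
  rw [nhds_discrete, tendsto_pure]
  rfl

theorem tendsto_point_iff (Y : ℕ → Boundary N) (X : Boundary N) :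
    Tendsto (fun n => point (Y n)) atTop (𝓝 (point X)) ↔ Tendsto Y atTop (𝓝 X) := by
  let _ : TopologicalSpace (Option (Fin N × Bool)) := ⊥
  have : DiscreteTopology (Option (Fin N × Bool)) := ⟨rfl⟩
  rw [tendsto_boundary_iff, nhds_induced, tendsto_comap_iff, tendsto_pi_nhds]
  refine forall_congr' fun i => ?_
  rw [nhds_discrete, tendsto_pure]
  simp [Compactification.letter]

theorem continuous_point : Continuous (point : Boundary N → Compactification N) := by
  let _ : TopologicalSpace (Option (Fin N × Bool)) := ⊥
  rw [continuous_induced_rng, continuous_pi_iff]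
  intro i
  have h : Continuous fun X : Boundary N => X.1 i :=
    (continuous_apply i).comp continuous_induced_dom
  exact (continuous_of_discreteTopology (f := fun x : Fin N × Bool => some x)).comp h

theorem exists_cylinder_subset {X : Boundary N} {U : Set (Boundary N)} (hU : U ∈ 𝓝 X) :
    ∃ j, ∀ Y : Boundary N, (∀ i < j, Y.1 i = X.1 i) → Y ∈ U := by
  by_contra! h
  choose Y hY hYU using h
  have : Tendsto Y atTop (𝓝 X) := (tendsto_boundary_iff _ _).2 fun i =>
    eventually_atTop.2 ⟨i + 1, fun n hn => hY n i (by omega)⟩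
  obtain ⟨n, hn⟩ := (this.eventually hU).exists
  exact hYU n hn

theorem tendsto_word_iff_prefix (g : ℕ → FreeGroup (Fin N)) (X : Boundary N) :
    Tendsto (fun n => word (g n)) atTop (𝓝 (point X)) ↔
      ∀ m, ∀ᶠ n in atTop, (List.range m).map X.1 <+: (g n).toWord := by
  rw [tendsto_word_iff]
  constructor
  · intro h m
    filter_upwards [(Finset.range m).eventually_all.2 fun i _ => h i] with n hn
    rw [List.prefix_iff_getElem?]
    intro i hi
    simp only [List.length_map, List.length_range] at hi
    simpa using hn i (Finset.mem_range.2 hi)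
  · intro h i
    filter_upwards [h (i + 1)] with n hn
    rw [List.prefix_iff_getElem?] at hn
    simpa using hn i (by simp)

theorem eventually_le_norm {g : ℕ → FreeGroup (Fin N)} {X : Boundary N}
    (h : Tendsto (fun n => word (g n)) atTop (𝓝 (point X))) (m : ℕ) :
    ∀ᶠ n in atTop, m ≤ (g n).norm := by
  filter_upwards [(tendsto_word_iff_prefix g X).1 h m] with n hn
  simpa [FreeGroup.norm] using hn.length_le

theorem tendsto_mul_const {g : ℕ → FreeGroup (Fin N)} {X : Boundary N}
    (h : Tendsto (fun n => word (g n)) atTop (𝓝 (point X))) (c : FreeGroup (Fin N)) :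
    Tendsto (fun n => word (g n * c)) atTop (𝓝 (point X)) := by
  rw [tendsto_word_iff]
  intro i
  filter_upwards [(tendsto_word_iff g X).1 h i, eventually_le_norm h (i + c.norm + 1)] with n h1 h2
  rw [getElem?_toWord_mul _ _ _ (by omega), h1]

theorem tendsto_take (X : Boundary N) :
    Tendsto (fun n => word (X.take n)) atTop (𝓝 (point X)) := by
  rw [tendsto_word_iff_prefix]
  intro m
  filter_upwards [eventually_ge_atTop m] with n hn
  rw [toWord_take]
  obtain ⟨k, rfl⟩ := Nat.exists_eq_add_of_le hn
  rw [List.range_add, List.map_append]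
  exact List.prefix_append _ _

/-! ### Extending automorphisms and translations to the boundary -/

theorem exists_norm_le_mul (ψ : MulAut (FreeGroup (Fin N))) :
    ∃ C, ∀ v, (ψ v).norm ≤ C * v.norm := by
  obtain ⟨C, hC⟩ := (Set.finite_range
    fun l : Fin N × Bool => (ψ (FreeGroup.mk [l])).norm).bddAbove
  refine ⟨C, fun v => ?_⟩
  have key : ∀ l : List (Fin N × Bool), (ψ (FreeGroup.mk l)).norm ≤ C * l.length := by
    intro l
    induction l with
    | nil => simp [← FreeGroup.one_eq_mk]
    | cons x l ih =>
      have : FreeGroup.mk (x :: l) = FreeGroup.mk [x] * FreeGroup.mk l := by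
        simp [FreeGroup.mul_mk]
      rw [this, map_mul]
      have h1 : (ψ (FreeGroup.mk [x])).norm ≤ C := hC ⟨x, rfl⟩
      have h2 := FreeGroup.norm_mul_le (ψ (FreeGroup.mk [x])) (ψ (FreeGroup.mk l))
      rw [List.length_cons, mul_add]
      omega
  have h := key v.toWord
  rwa [FreeGroup.mk_toWord] at h

/-- Words with a long common prefix have images with a common prefix: along the path from `l` to
`l ++ l'` the image moves by bounded steps and, since the inverse is Lipschitz, stays far from the
identity, so that its first letters do not change. -/
theorem exists_getElem?_map_append (ψ : MulAut (FreeGroup (Fin N))) (i : ℕ) :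
    ∃ j, ∀ l l' : List (Fin N × Bool), FreeGroup.IsReduced (l ++ l') → j ≤ l.length →
      (ψ (FreeGroup.mk (l ++ l'))).toWord[i]? = (ψ (FreeGroup.mk l)).toWord[i]? := by
  obtain ⟨C, hC⟩ := exists_norm_le_mul ψ
  obtain ⟨D, hD⟩ := exists_norm_le_mul ψ⁻¹
  refine ⟨D * (i + C) + 1, fun l l' => ?_⟩
  induction l' using List.reverseRecOn with
  | nil => simp
  | append_singleton l' x ih =>
    intro hred hl
    have hred' : FreeGroup.IsReduced (l ++ l') :=
      hred.infix (by rw [← List.append_assoc]; exact (List.prefix_append _ _).isInfix)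
    rw [← ih hred' hl, ← List.append_assoc, ← FreeGroup.mul_mk, map_mul]
    apply getElem?_toWord_mul
    have h1 := hC (FreeGroup.mk [x])
    have h2 := hD (ψ (FreeGroup.mk (l ++ l')))
    rw [MulAut.inv_apply_self, FreeGroup.norm, toWord_mk_of_isReduced hred',
      List.length_append] at h2
    have h3 : (FreeGroup.mk [x]).norm ≤ 1 := FreeGroup.norm_mk_le
    have h4 : C * (FreeGroup.mk [x]).norm ≤ C * 1 := Nat.mul_le_mul_left _ h3
    by_contra hcon
    have h5 : D * (ψ (FreeGroup.mk (l ++ l'))).norm ≤ D * (i + C) :=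
      Nat.mul_le_mul_left _ (by omega)
    omega

theorem tendsto_map {ψ : MulAut (FreeGroup (Fin N))} {g : ℕ → FreeGroup (Fin N)} {Y : Boundary N}
    (h : Tendsto (fun n => word (g n)) atTop (𝓝 (point Y))) :
    Tendsto (fun n => word (ψ (g n))) atTop (𝓝 (point (boundaryMap ψ Y))) := by
  have hY : Tendsto (fun n => word (ψ (Y.take n))) atTop (𝓝 (point (boundaryMap ψ Y))) :=
    (exists_tendsto_map ψ Y).choose_spec
  rw [tendsto_word_iff]
  intro i
  obtain ⟨j, hj⟩ := exists_getElem?_map_append ψ i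
  obtain ⟨m, hm, hjm⟩ := (((tendsto_word_iff _ _).1 hY i).and (eventually_ge_atTop j)).exists
  filter_upwards [(tendsto_word_iff_prefix g Y).1 h m] with n hn
  obtain ⟨l', hl'⟩ := hn
  rw [← hm, ← FreeGroup.mk_toWord (x := g n), ← hl', hj _ _ ?_ (by simpa using hjm)]
  · rfl
  · rw [hl']; exact FreeGroup.isReduced_toWord

theorem tendsto_pow_map (ψ : MulAut (FreeGroup (Fin N))) (Y : Boundary N) (n : ℕ) :
    Tendsto (fun m => word ((ψ ^ n) (Y.take m))) atTop (𝓝 (point ((boundaryMap ψ)^[n] Y))) := by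
  induction n with
  | zero => simpa using tendsto_take Y
  | succ n ih =>
    rw [Function.iterate_succ_apply', pow_succ']
    exact tendsto_map ih

theorem iterate_extendedMap_point (ψ : MulAut (FreeGroup (Fin N))) (Y : Boundary N) (n : ℕ) :
    (extendedMap ψ)^[n] (point Y) = point ((boundaryMap ψ)^[n] Y) := by
  induction n with
  | zero => rfl
  | succ n ih => rw [Function.iterate_succ_apply', Function.iterate_succ_apply', ih]; rfl

theorem iterate_extendedMap_word (ψ : MulAut (FreeGroup (Fin N))) (g : FreeGroup (Fin N)) (n : ℕ) :
    (extendedMap ψ)^[n] (word g) = word ((ψ ^ n) g) := by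
  induction n with
  | zero => rfl
  | succ n ih => rw [Function.iterate_succ_apply', ih, pow_succ']; rfl

theorem IsAttracting.isBoundaryAttracting {ψ : MulAut (FreeGroup (Fin N))} {X : Boundary N}
    (h : IsAttracting ψ X) : IsBoundaryAttracting ψ X := by
  obtain ⟨U, hU, h⟩ := h
  refine ⟨point ⁻¹' U, continuous_point.continuousAt hU, fun Y hY => ?_⟩
  have := h _ hY
  simpa only [iterate_extendedMap_point, tendsto_point_iff] using this

theorem tendsto_smul (v : FreeGroup (Fin N)) (X : Boundary N) :
    Tendsto (fun n => word (v * X.take n)) atTop (𝓝 (point (v • X))) :=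
  (exists_tendsto_mul v X).choose_spec

theorem smul_eq_of_tendsto {v : FreeGroup (Fin N)} {X Y : Boundary N}
    (h : Tendsto (fun n => word (v * X.take n)) atTop (𝓝 (point Y))) : v • X = Y :=
  tendsto_word_unique (tendsto_smul v X) h

theorem one_smul_boundary (X : Boundary N) : (1 : FreeGroup (Fin N)) • X = X :=
  smul_eq_of_tendsto (by simpa using tendsto_take X)

/-- In `a⁻¹ b` the part of `b` from a disagreement with `a` on is not cancelled. -/
theorem drop_suffix_toWord_inv_mul (i : ℕ) (a b : List (Fin N × Bool))
    (ha : FreeGroup.IsReduced a) (hb : FreeGroup.IsReduced b)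
    (h : ∀ x, a[i]? = some x → b[i]? ≠ some x) :
    b.drop i <:+ ((FreeGroup.mk a)⁻¹ * FreeGroup.mk b).toWord := by
  induction a generalizing b i with
  | nil =>
    rw [← FreeGroup.one_eq_mk, inv_one, one_mul, toWord_mk_of_isReduced hb]
    exact List.drop_suffix _ _
  | cons x a ih =>
    cases b with
    | nil => simp
    | cons y b =>
      by_cases hxy : x = y
      · subst hxy
        cases i with
        | zero => simp at h
        | succ i =>
          have e : (FreeGroup.mk (x :: a))⁻¹ * FreeGroup.mk (x :: b) =
              (FreeGroup.mk a)⁻¹ * FreeGroup.mk b := by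
            rw [← List.singleton_append, ← List.singleton_append (l := b), ← FreeGroup.mul_mk,
              ← FreeGroup.mul_mk]
            group
          rw [e]
          exact ih i b (ha.infix (List.suffix_cons x a).isInfix)
            (hb.infix (List.suffix_cons x b).isInfix) (by simpa using h)
      · have hred : FreeGroup.IsReduced (FreeGroup.invRev (x :: a) ++ y :: b) := by
          have hinv : FreeGroup.IsReduced (FreeGroup.invRev (x :: a)) := by
            rw [← toWord_mk_of_isReduced ha, ← FreeGroup.toWord_inv]
            exact FreeGroup.isReduced_toWord
          rw [FreeGroup.IsReduced, List.isChain_append]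
          refine ⟨hinv, hb, ?_⟩
          intro z hz z' hz'
          rw [FreeGroup.invRev] at hz
          simp at hz hz'
          subst hz hz'
          intro h1
          by_contra h2
          exact hxy (Prod.ext h1 (by simpa using h2))
        rw [FreeGroup.inv_mk, FreeGroup.mul_mk, toWord_mk_of_isReduced hred]
        exact (List.drop_suffix _ _).trans (List.suffix_append _ _)

theorem take_eq_of_prefix {X : Boundary N} {g : FreeGroup (Fin N)} {m : ℕ} {l : List (Fin N × Bool)}
    (h1 : g.toWord <+: l) (h2 : (List.range m).map X.1 <+: l) (hm : g.norm ≤ m) :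
    g = X.take g.norm := by
  apply FreeGroup.toWord_injective
  rw [toWord_take]
  have h3 : g.toWord <+: (List.range m).map X.1 :=
    List.prefix_of_prefix_length_le h1 h2 (by simpa [FreeGroup.norm] using hm)
  rw [List.prefix_iff_eq_take] at h3
  rw [h3, ← List.map_take, List.take_range]
  congr 2
  exact min_eq_left hm

/-- The limit of an increasing sequence of words has all these words as prefixes. -/
theorem eq_take_of_prefix_succ {g : ℕ → FreeGroup (Fin N)} {X : Boundary N}
    (hg : Tendsto (fun n => word (g n)) atTop (𝓝 (point X)))
    (hp : ∀ n, (g n).toWord <+: (g (n + 1)).toWord) (n : ℕ) : g n = X.take (g n).norm := by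
  have hmono : ∀ m ≥ n, (g n).toWord <+: (g m).toWord := fun m hm => by
    induction m, hm using Nat.le_induction with
    | base => exact List.prefix_refl _
    | succ m _ ih => exact ih.trans (hp m)
  obtain ⟨m, hm, hnm⟩ :=
    (((tendsto_word_iff_prefix g X).1 hg (g n).norm).and (eventually_ge_atTop n)).exists
  exact take_eq_of_prefix (hmono m hnm) hm le_rfl

/-- Beyond the length of `v`, translation by `v` only shifts the prefixes. -/
theorem mul_take_eq (v : FreeGroup (Fin N)) (X : Boundary N) (n : ℕ) :
    v * X.take (v.norm + n) = (v • X).take ((v * X.take v.norm).norm + n) := by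
  have hred : ∀ n, (v * X.take (v.norm + n)).toWord =
      (v * X.take v.norm).toWord ++ (List.range n).map fun i => X.1 (v.norm + i) := by
    intro n
    have h := drop_suffix_toWord_inv_mul v.norm v⁻¹.toWord (X.take (v.norm + n)).toWord
      FreeGroup.isReduced_toWord FreeGroup.isReduced_toWord
      (by
        intro x hx
        rw [List.getElem?_eq_none (by rw [← FreeGroup.norm, FreeGroup.norm_inv_eq])] at hx
        simp at hx)
    rw [FreeGroup.mk_toWord, FreeGroup.mk_toWord, inv_inv, toWord_take (n := v.norm + n),
      List.range_add, List.map_append, List.drop_left' (by simp), List.map_map] at h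
    obtain ⟨p, hp⟩ := h
    have hp1 : FreeGroup.IsReduced p :=
      FreeGroup.isReduced_toWord.infix (hp ▸ (List.prefix_append _ _).isInfix)
    have hp2 : FreeGroup.mk p = v * X.take v.norm := by
      have h3 := congrArg FreeGroup.mk hp
      rw [FreeGroup.mk_toWord, ← FreeGroup.mul_mk] at h3
      have h4 : X.take (v.norm + n) =
          X.take v.norm * FreeGroup.mk ((List.range n).map fun i => X.1 (v.norm + i)) := by
        rw [Boundary.take, List.range_add, List.map_append, ← FreeGroup.mul_mk, List.map_map]
        rfl
      rw [h4, ← mul_assoc] at h3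
      exact mul_right_cancel h3
    rw [← hp2, toWord_mk_of_isReduced hp1, ← hp]
    rfl
  have hlim : Tendsto (fun n => word (v * X.take (v.norm + n))) atTop (𝓝 (point (v • X))) := by
    simpa only [add_comm] using (tendsto_add_atTop_iff_nat v.norm).2 (tendsto_smul v X)
  have := eq_take_of_prefix_succ hlim (fun n => by
    rw [hred, hred, List.range_succ, List.map_append, ← List.append_assoc]
    exact List.prefix_append _ _) n
  rw [this]
  congr 1
  rw [FreeGroup.norm, hred]
  simp [FreeGroup.norm]

theorem tendsto_mul_left {g : ℕ → FreeGroup (Fin N)} {X : Boundary N}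
    (h : Tendsto (fun n => word (g n)) atTop (𝓝 (point X))) (v : FreeGroup (Fin N)) :
    Tendsto (fun n => word (v * g n)) atTop (𝓝 (point (v • X))) := by
  have hconj : Tendsto (fun n => word (v * X.take n * v⁻¹)) atTop (𝓝 (point (v • X))) :=
    tendsto_mul_const (tendsto_smul v X) _
  have e : boundaryMap (MulAut.conj v) X = v • X :=
    tendsto_word_unique (exists_tendsto_map (MulAut.conj v) X).choose_spec hconj
  have h1 := tendsto_mul_const (tendsto_map (ψ := MulAut.conj v) h) v
  simpa [e] using h1

theorem mul_smul_boundary (u v : FreeGroup (Fin N)) (X : Boundary N) :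
    (u * v) • X = u • v • X :=
  smul_eq_of_tendsto (by simpa only [mul_assoc] using tendsto_mul_left (tendsto_smul v X) u)

/-- A group element that fixes a boundary point has it as the limit of its positive or negative
powers: on long prefixes of the point it acts as a shift. -/
theorem exists_tendsto_pow_of_smul_eq {u : FreeGroup (Fin N)} (hu : u ≠ 1) {X : Boundary N}
    (h : u • X = X) :
    ∃ z : FreeGroup (Fin N), (z = u ∨ z = u⁻¹) ∧
      Tendsto (fun m : ℕ => word (z ^ m)) atTop (𝓝 (point X)) := by
  -- An element that pushes long prefixes away from the identity has its powers converging to `X`.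
  have key : ∀ (z : FreeGroup (Fin N)) (n₀ k : ℕ), 0 < k →
      (∀ n ≥ n₀, z * X.take n = X.take (n + k)) →
      Tendsto (fun m : ℕ => word (z ^ m)) atTop (𝓝 (point X)) := by
    intro z n₀ k hk hz
    have hpow : ∀ m : ℕ, z ^ m * X.take n₀ = X.take (n₀ + m * k) := by
      intro m
      induction m with
      | zero => simp
      | succ m ih =>
        rw [pow_succ', mul_assoc, ih, hz _ (by omega)]
        congr 1; ring
    have hlim : Tendsto (fun m : ℕ => n₀ + m * k) atTop atTop :=
      tendsto_atTop_mono (fun m => (Nat.le_mul_of_pos_right m hk).trans le_add_self) tendsto_id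
    have := tendsto_mul_const ((tendsto_take X).comp hlim) (X.take n₀)⁻¹
    refine this.congr fun m => ?_
    rw [← hpow, mul_inv_cancel_right]
  have hs := mul_take_eq u X
  rw [h] at hs
  rcases lt_trichotomy (u * X.take u.norm).norm u.norm with hlt | heq | hgt
  · refine ⟨u⁻¹, Or.inr rfl, key _ (u * X.take u.norm).norm
      (u.norm - (u * X.take u.norm).norm) (by omega) fun n hn => ?_⟩
    obtain ⟨j, rfl⟩ := Nat.exists_eq_add_of_le hn
    rw [inv_mul_eq_iff_eq_mul, ← hs]
    congr 2; omega
  · exfalso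
    apply hu
    have := hs 0
    rw [heq] at this
    simpa using this
  · refine ⟨u, Or.inl rfl, key _ u.norm
      ((u * X.take u.norm).norm - u.norm) (by omega) fun n hn => ?_⟩
    obtain ⟨j, rfl⟩ := Nat.exists_eq_add_of_le hn
    rw [hs]
    congr 1; omega

/-! ### Legal words -/

/-- All letters of the word have exponent sign `ε`: basis elements for `true`, inverses of basis
elements for `false`. -/
def HasSign (ε : Bool) (l : List (Fin N × Bool)) : Prop :=
  ∀ x ∈ l, x.2 = ε

theorem HasSign.isReduced {ε : Bool} {l : List (Fin N × Bool)} (h : HasSign ε l) :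
    FreeGroup.IsReduced l := by
  rw [FreeGroup.IsReduced, List.isChain_iff_getElem]
  intro i hi _
  rw [h _ (List.getElem_mem _), h _ (List.getElem_mem _)]

theorem HasSign.append {ε : Bool} {l l' : List (Fin N × Bool)} (h : HasSign ε l)
    (h' : HasSign ε l') : HasSign ε (l ++ l') := fun x hx =>
  (List.mem_append.1 hx).elim (h x) (h' x)

theorem HasSign.infix {ε : Bool} {l l' : List (Fin N × Bool)} (h : HasSign ε l')
    (hl : l <:+: l') : HasSign ε l := fun x hx => h x (hl.subset hx)

theorem HasSign.invRev {ε : Bool} {l : List (Fin N × Bool)} (h : HasSign ε l) :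
    HasSign (!ε) (FreeGroup.invRev l) := by
  intro x hx
  simp only [FreeGroup.invRev, List.mem_reverse, List.mem_map] at hx
  obtain ⟨y, hy, rfl⟩ := hx
  simp [h y hy]

/-- No cancellation between words of the same sign. -/
theorem toWord_mul_of_hasSign {ε : Bool} {g h : FreeGroup (Fin N)} (hg : HasSign ε g.toWord)
    (hh : HasSign ε h.toWord) : (g * h).toWord = g.toWord ++ h.toWord := by
  rw [FreeGroup.toWord_mul, (hg.append hh).isReduced.reduce_eq]

theorem HasSign.mul {ε : Bool} {g h : FreeGroup (Fin N)} (hg : HasSign ε g.toWord)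
    (hh : HasSign ε h.toWord) : HasSign ε (g * h).toWord := by
  rw [toWord_mul_of_hasSign hg hh]
  exact hg.append hh

theorem toWord_mk_singleton (x : Fin N × Bool) : (FreeGroup.mk [x]).toWord = [x] := by
  rw [FreeGroup.toWord_mk]; rfl

theorem mk_singleton_not (a : Fin N) (ε : Bool) :
    FreeGroup.mk [(a, !ε)] = (FreeGroup.mk [(a, ε)])⁻¹ := by
  simp [FreeGroup.inv_mk, FreeGroup.invRev]

theorem HasSign.map {φ : MulAut (FreeGroup (Fin N))} (hpos : IsPositive φ) {ε : Bool}
    {g : FreeGroup (Fin N)} (hg : HasSign ε g.toWord) : HasSign ε (φ g).toWord := by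
  have hletter : ∀ a, HasSign ε (φ (FreeGroup.mk [(a, ε)])).toWord := by
    intro a
    have h : HasSign true (φ (FreeGroup.mk [(a, true)])).toWord := (hpos a).2
    cases ε with
    | true => exact h
    | false =>
      rw [← Bool.not_true, mk_singleton_not, map_inv, FreeGroup.toWord_inv]
      exact h.invRev
  rw [← FreeGroup.mk_toWord (x := g)]
  generalize g.toWord = l at hg
  induction l with
  | nil =>
    rw [← FreeGroup.one_eq_mk, map_one, FreeGroup.toWord_one]
    simp [HasSign]
  | cons x l ih =>
    rw [← List.singleton_append, ← FreeGroup.mul_mk, map_mul]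
    refine HasSign.mul ?_ (ih fun y hy => hg y (List.mem_cons_of_mem _ hy))
    have hx : x.2 = ε := hg x List.mem_cons_self
    obtain ⟨a, b⟩ := x
    subst hx
    exact hletter a

theorem HasSign.map_pow {φ : MulAut (FreeGroup (Fin N))} (hpos : IsPositive φ) {ε : Bool}
    {g : FreeGroup (Fin N)} (hg : HasSign ε g.toWord) (n : ℕ) :
    HasSign ε ((φ ^ n) g).toWord := by
  induction n with
  | zero => simpa using hg
  | succ n ih =>
    rw [pow_succ']
    exact ih.map hpos

theorem hasSign_pow_letter {φ : MulAut (FreeGroup (Fin N))} (hpos : IsPositive φ) (n : ℕ)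
    (a : Fin N) (ε : Bool) : HasSign ε ((φ ^ n) (FreeGroup.mk [(a, ε)])).toWord :=
  HasSign.map_pow hpos (by rw [toWord_mk_singleton]; simp [HasSign]) n

theorem infix_map_pow {φ : MulAut (FreeGroup (Fin N))} (hpos : IsPositive φ) {ε : Bool}
    {l : List (Fin N × Bool)} {g : FreeGroup (Fin N)} (hg : HasSign ε g.toWord)
    (hl : l <:+: g.toWord) (n : ℕ) :
    ((φ ^ n) (FreeGroup.mk l)).toWord <:+: ((φ ^ n) g).toWord := by
  obtain ⟨p, s, h⟩ := hl
  have e : g = FreeGroup.mk p * FreeGroup.mk l * FreeGroup.mk s := by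
    rw [FreeGroup.mul_mk, FreeGroup.mul_mk, h, FreeGroup.mk_toWord]
  have hsub : ∀ l', l' <:+: g.toWord → HasSign ε ((φ ^ n) (FreeGroup.mk l')).toWord := by
    intro l' hl'
    apply HasSign.map_pow hpos
    rw [toWord_mk_of_isReduced (hg.infix hl').isReduced]
    exact hg.infix hl'
  have hp := hsub p ⟨[], l ++ s, by simpa using h⟩
  have hl := hsub l ⟨p, s, h⟩
  have hs := hsub s ⟨p ++ l, [], by simpa using h⟩
  rw [e, map_mul, map_mul, toWord_mul_of_hasSign (hp.mul hl) hs, toWord_mul_of_hasSign hp hl]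
  exact ⟨_, _, rfl⟩

/-- A word is legal of sign `ε` if it is a factor of the image of a letter of that sign under some
iterate of `φ`. The legal words of sign `true` are the words of the attracting subshift, and those
of sign `false` are their inverses. -/
def IsLegal (φ : MulAut (FreeGroup (Fin N))) (ε : Bool) (l : List (Fin N × Bool)) : Prop :=
  ∃ (n : ℕ) (a : Fin N), l <:+: ((φ ^ n) (FreeGroup.mk [(a, ε)])).toWord

theorem IsLegal.infix {φ : MulAut (FreeGroup (Fin N))} {ε : Bool} {l l' : List (Fin N × Bool)}
    (h : IsLegal φ ε l') (hl : l <:+: l') : IsLegal φ ε l := by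
  obtain ⟨n, a, h⟩ := h
  exact ⟨n, a, hl.trans h⟩

theorem IsLegal.hasSign {φ : MulAut (FreeGroup (Fin N))} (hpos : IsPositive φ) {ε : Bool}
    {l : List (Fin N × Bool)} (h : IsLegal φ ε l) : HasSign ε l := by
  obtain ⟨n, a, h⟩ := h
  exact (hasSign_pow_letter hpos n a ε).infix h

theorem isLegal_pow_letter (φ : MulAut (FreeGroup (Fin N))) (n : ℕ) (x : Fin N × Bool) :
    IsLegal φ x.2 ((φ ^ n) (FreeGroup.mk [x])).toWord :=
  ⟨n, x.1, List.infix_refl _⟩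

theorem IsLegal.inv {φ : MulAut (FreeGroup (Fin N))} {ε : Bool} {g : FreeGroup (Fin N)}
    (h : IsLegal φ ε g.toWord) : IsLegal φ (!ε) g⁻¹.toWord := by
  obtain ⟨n, a, p, s, h⟩ := h
  refine ⟨n, a, FreeGroup.invRev s, FreeGroup.invRev p, ?_⟩
  rw [mk_singleton_not, map_inv, FreeGroup.toWord_inv, FreeGroup.toWord_inv, ← h]
  simp [FreeGroup.invRev]

theorem IsLegal.map_pow {φ : MulAut (FreeGroup (Fin N))} (hpos : IsPositive φ) {ε : Bool}
    {g : FreeGroup (Fin N)} (h : IsLegal φ ε g.toWord) (m : ℕ) :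
    IsLegal φ ε ((φ ^ m) g).toWord := by
  obtain ⟨n, a, h⟩ := h
  refine ⟨m + n, a, ?_⟩
  have := infix_map_pow hpos (hasSign_pow_letter hpos n a ε) h m
  rwa [FreeGroup.mk_toWord, ← MulAut.mul_apply, ← pow_add] at this

theorem exists_mem_map_pow {φ : MulAut (FreeGroup (Fin N))} (hpos : IsPositive φ)
    (hprim : IsPrimitive φ) : ∃ k, ∀ r ≥ k, ∀ (ε : Bool) (b : Fin N) (g : FreeGroup (Fin N)),
      g ≠ 1 → HasSign ε g.toWord → (b, ε) ∈ ((φ ^ r) g).toWord := by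
  obtain ⟨k, -, hk⟩ := hprim
  have hk' : ∀ (ε : Bool) (a b : Fin N), (b, ε) ∈ ((φ ^ k) (FreeGroup.mk [(a, ε)])).toWord := by
    intro ε a b
    cases ε with
    | true => exact hk a b
    | false =>
      rw [← Bool.not_true, mk_singleton_not, map_inv, FreeGroup.toWord_inv, FreeGroup.invRev,
        List.mem_reverse, List.mem_map]
      exact ⟨(b, true), hk a b, rfl⟩
  refine ⟨k, fun r hr ε b g hg hs => ?_⟩
  obtain ⟨j, rfl⟩ := Nat.exists_eq_add_of_le hr
  rw [pow_add, MulAut.mul_apply]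
  have hs' := hs.map_pow hpos j
  have hne : ((φ ^ j) g).toWord ≠ [] := by
    rwa [Ne, FreeGroup.toWord_eq_nil_iff, EmbeddingLike.map_eq_one_iff]
  obtain ⟨⟨c, δ⟩, hc⟩ := List.exists_mem_of_ne_nil _ hne
  obtain rfl : δ = ε := hs' _ hc
  exact (infix_map_pow hpos hs' (List.singleton_infix_iff _ _ |>.2 hc) k).subset (hk' δ c b)

/-! ### Rays of the attracting subshift -/

/-- All factors of the ray are legal of sign `ε`. -/
def IsLegalRay (φ : MulAut (FreeGroup (Fin N))) (ε : Bool) (X : Boundary N) : Prop :=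
  ∀ m, IsLegal φ ε (X.take m).toWord

/-- The factors of the ray are exactly the legal words of sign `ε`. -/
def IsGenericRay (φ : MulAut (FreeGroup (Fin N))) (ε : Bool) (X : Boundary N) : Prop :=
  IsLegalRay φ ε X ∧ ∀ l, IsLegal φ ε l → ∃ m, l <:+: (X.take m).toWord

theorem IsLegalRay.sign {φ : MulAut (FreeGroup (Fin N))} (hpos : IsPositive φ) {ε : Bool}
    {X : Boundary N} (h : IsLegalRay φ ε X) (i : ℕ) : (X.1 i).2 = ε := by
  refine (h (i + 1)).hasSign hpos _ ?_
  rw [toWord_take]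
  exact List.mem_map_of_mem (by simp)

theorem isGenericRay_of_tendsto {φ : MulAut (FreeGroup (Fin N))} {ε : Bool}
    {g : ℕ → FreeGroup (Fin N)} {X : Boundary N}
    (hlim : Tendsto (fun n => word (g n)) atTop (𝓝 (point X)))
    (hp : ∀ n, (g n).toWord <+: (g (n + 1)).toWord) (hlegal : ∀ n, IsLegal φ ε (g n).toWord)
    (hl : ∀ l, IsLegal φ ε l → ∃ n, l <:+: (g n).toWord) : IsGenericRay φ ε X := by
  refine ⟨fun m => ?_, fun l h => ?_⟩
  · obtain ⟨n, hn⟩ := ((tendsto_word_iff_prefix g X).1 hlim m).exists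
    rw [toWord_take]
    exact (hlegal n).infix hn.isInfix
  · obtain ⟨n, hn⟩ := hl l h
    rw [eq_take_of_prefix_succ hlim hp n] at hn
    exact ⟨_, hn⟩

theorem iterProd_succ (φ : MulAut (FreeGroup (Fin N))) (g : FreeGroup (Fin N)) (n : ℕ) :
    iterProd φ g (n + 1) = iterProd φ g n * (φ ^ (n + 1)) g := by
  rw [iterProd, List.range_succ, List.map_append, List.prod_append, iterProd]
  simp

/-- If `φᵏ` maps the letter `x` to `q x t` without cancellation, then the ray
`t φᵏ(t) φ²ᵏ(t) ⋯`, with or without `x` in front, has the legal words as its factors. -/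
theorem isGenericRay_of_iterProd {φ : MulAut (FreeGroup (Fin N))} (hpos : IsPositive φ)
    (hprim : IsPrimitive φ) {k : ℕ} {a : Fin N} {ε : Bool} {q t c : FreeGroup (Fin N)}
    (hq : HasSign ε q.toWord) (ht : HasSign ε t.toWord) (ht1 : t ≠ 1)
    (h : (φ ^ k) (FreeGroup.mk [(a, ε)]) = q * FreeGroup.mk [(a, ε)] * t)
    (hc : c = 1 ∨ c = FreeGroup.mk [(a, ε)]) {X : Boundary N}
    (hlim : Tendsto (fun n => word (c * iterProd (φ ^ k) t n)) atTop (𝓝 (point X))) :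
    IsGenericRay φ ε X := by
  have hx : HasSign ε (FreeGroup.mk [(a, ε)]).toWord := by
    rw [toWord_mk_singleton]; simp [HasSign]
  have hcs : HasSign ε c.toWord := by
    rcases hc with rfl | rfl
    · simp [HasSign]
    · exact hx
  have hk : 1 ≤ k := by
    by_contra hk
    obtain rfl : k = 0 := by omega
    have := congrArg (fun g => g.toWord.length) h
    simp only [toWord_mul_of_hasSign (hq.mul hx) ht, toWord_mul_of_hasSign hq hx, pow_zero,
      MulAut.one_apply, toWord_mk_singleton, List.length_append, List.length_singleton] at this
    apply ht1
    rw [← FreeGroup.toWord_eq_nil_iff, ← List.length_eq_zero_iff]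
    omega
  have hpw : ∀ n, HasSign ε (((φ ^ k) ^ n) t).toWord := fun n => by
    rw [← pow_mul]; exact ht.map_pow hpos _
  have hg : ∀ n, HasSign ε (iterProd (φ ^ k) t n).toWord := by
    intro n
    induction n with
    | zero => simpa [iterProd] using ht
    | succ n ih => rw [iterProd_succ]; exact ih.mul (hpw _)
  have hdec : ∀ n, ∃ β : FreeGroup (Fin N), HasSign ε β.toWord ∧
      ((φ ^ k) ^ (n + 1)) (FreeGroup.mk [(a, ε)]) =
        β * FreeGroup.mk [(a, ε)] * iterProd (φ ^ k) t n := by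
    intro n
    induction n with
    | zero => exact ⟨q, hq, by simpa [iterProd] using h⟩
    | succ n ih =>
      obtain ⟨β, hβ, e⟩ := ih
      refine ⟨((φ ^ k) ^ (n + 1)) q * β, ?_, ?_⟩
      · refine HasSign.mul ?_ hβ
        rw [← pow_mul]; exact hq.map_pow hpos _
      · rw [pow_succ _ (n + 1), MulAut.mul_apply, h, map_mul, map_mul, e, iterProd_succ]
        group
  refine isGenericRay_of_tendsto hlim (fun n => ?_) (fun n => ?_) fun l hl => ?_
  · rw [iterProd_succ, ← mul_assoc, toWord_mul_of_hasSign (hcs.mul (hg n)) (hpw _)]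
    exact List.prefix_append _ _
  · obtain ⟨β, hβ, e⟩ := hdec n
    have h1 := isLegal_pow_letter φ (k * (n + 1)) (a, ε)
    rw [pow_mul, e, mul_assoc, toWord_mul_of_hasSign hβ (hx.mul (hg n))] at h1
    have h2 := h1.infix (List.suffix_append _ _).isInfix
    rcases hc with rfl | rfl
    · rw [toWord_mul_of_hasSign hx (hg n)] at h2
      rw [one_mul]
      exact h2.infix (List.suffix_append _ _).isInfix
    · exact h2
  · obtain ⟨m, b, hl⟩ := hl
    obtain ⟨r, hr⟩ := exists_mem_map_pow hpos hprim
    refine ⟨m + r + 1, hl.trans ?_⟩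
    have hle : m + r ≤ k * (m + r + 1) := by nlinarith
    have hb : (b, ε) ∈ ((φ ^ (k * (m + r + 1) - m)) t).toWord := hr _ (by omega) ε b t ht1 ht
    have h1 := infix_map_pow hpos (ht.map_pow hpos _) (List.singleton_infix_iff _ _ |>.2 hb) m
    rw [← MulAut.mul_apply, ← pow_add, Nat.add_sub_cancel' (by omega), pow_mul] at h1
    rw [iterProd_succ, ← mul_assoc, toWord_mul_of_hasSign (hcs.mul (hg _)) (hpw _)]
    exact h1.trans (List.suffix_append _ _).isInfix

theorem IsGeneratingPair.isGenericRay {φ : MulAut (FreeGroup (Fin N))} (hpos : IsPositive φ)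
    (hprim : IsPrimitive φ) {Z : Boundary N × Boundary N} (hZ : IsGeneratingPair φ Z) :
    IsGenericRay φ false Z.1 ∧ IsGenericRay φ true Z.2 := by
  obtain ⟨a, k, p, s, hp, hs, h, h1, h2⟩ := hZ
  have hp' : HasSign false p⁻¹.toWord := by
    rw [FreeGroup.toWord_inv]; exact HasSign.invRev (ε := true) hp.2
  have hs' : HasSign false s⁻¹.toWord := by
    rw [FreeGroup.toWord_inv]; exact HasSign.invRev (ε := true) hs.2
  constructor
  · refine isGenericRay_of_iterProd (a := a) (c := 1) hpos hprim hs' hp' (inv_ne_one.2 hp.1) ?_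
      (Or.inl rfl) (by simpa using h1)
    rw [← Bool.not_true, mk_singleton_not, map_inv]
    change ((φ ^ k) (FreeGroup.of a))⁻¹ = s⁻¹ * (FreeGroup.of a)⁻¹ * p⁻¹
    rw [h]; group
  · exact isGenericRay_of_iterProd (a := a) hpos hprim hp.2 hs.2 hs.1 h (Or.inr rfl) h2

/-! ### Legal rays belong to the half lamination -/

/-- The infinite word without its first `n` letters. -/
def Boundary.drop (X : Boundary N) (n : ℕ) : Boundary N :=
  ⟨fun i => X.1 (n + i), fun i => X.2 (n + i)⟩

theorem take_add (X : Boundary N) (n m : ℕ) : X.take (n + m) = X.take n * (X.drop n).take m := by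
  rw [Boundary.take, List.range_add, List.map_append, ← FreeGroup.mul_mk, List.map_map]
  rfl

theorem take_smul_drop (X : Boundary N) (n : ℕ) : X.take n • X.drop n = X := by
  apply smul_eq_of_tendsto
  simp only [← take_add, add_comm n]
  exact (tendsto_add_atTop_iff_nat n).2 (tendsto_take X)

theorem head_inv_smul (X : Boundary N) : X.head⁻¹ • X = X.drop 1 := by
  have h : X.head • X.drop 1 = X := take_smul_drop X 1
  calc X.head⁻¹ • X = X.head⁻¹ • X.head • X.drop 1 := by rw [h]
    _ = X.drop 1 := by rw [← mul_smul_boundary, inv_mul_cancel, one_smul_boundary]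

theorem head_mk_singleton_smul {x : Fin N × Bool} {Y : Boundary N}
    (h : x.1 = (Y.1 0).1 → x.2 = (Y.1 0).2) : (FreeGroup.mk [x] • Y).1 0 = x := by
  obtain ⟨n, hn⟩ := ((tendsto_word_iff _ _).1 (tendsto_smul (FreeGroup.mk [x]) Y) 0).exists
  have hred : FreeGroup.IsReduced (x :: (List.range n).map Y.1) := by
    rw [FreeGroup.IsReduced, List.isChain_cons]
    refine ⟨fun y hy => ?_, by
      rw [← toWord_take]; exact FreeGroup.isReduced_toWord⟩
    cases n with
    | zero => simp at hy
    | succ n => simp [List.range_succ_eq_map] at hy; subst hy; exact h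
  rw [Boundary.take, FreeGroup.mul_mk, List.singleton_append, toWord_mk_of_isReduced hred] at hn
  simpa using hn.symm

theorem iterate_shiftInv {ε : Bool} {P Q : Boundary N} (hP : ∀ i, (P.1 i).2 = ε)
    (hQ : (Q.1 0).2 = !ε) (j : ℕ) :
    (shiftInv^[j] (P, Q)).1 = P.drop j ∧ ((shiftInv^[j] (P, Q)).2.1 0).2 = !ε := by
  induction j with
  | zero => exact ⟨boundary_ext fun i => by simp [Boundary.drop], hQ⟩
  | succ j ih =>
    rw [Function.iterate_succ_apply', shiftInv, ih.1]
    refine ⟨?_, ?_⟩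
    · rw [head_inv_smul]
      exact boundary_ext fun i => by simp [Boundary.drop, add_assoc]
    · have e : ((P.drop j).head)⁻¹ = FreeGroup.mk [((P.1 j).1, !ε)] := by
        rw [mk_singleton_not, ← hP j]
        rfl
      simp only [e]
      rw [head_mk_singleton_smul]
      intro _
      exact ih.2.symm

theorem isClosedEmbedding_val :
    IsClosedEmbedding (Subtype.val : Boundary N → ℕ → Fin N × Bool) := by
  refine ⟨⟨⟨rfl⟩, Subtype.val_injective⟩, ?_⟩
  rw [Subtype.range_val_subtype]
  have : {X : ℕ → Fin N × Bool | ∀ i, (X i).1 = (X (i + 1)).1 → (X i).2 = (X (i + 1)).2} =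
      ⋂ i, (fun X : ℕ → Fin N × Bool => (X i, X (i + 1))) ⁻¹'
        {x | x.1.1 = x.2.1 → x.1.2 = x.2.2} := by
    ext X; simp
  rw [this]
  exact isClosed_iInter fun i => (isClosed_discrete _).preimage (by fun_prop)

instance : CompactSpace (Boundary N) := isClosedEmbedding_val.compactSpace

instance : T2Space (Boundary N) := isClosedEmbedding_val.isEmbedding.t2Space

theorem continuous_letter (i : ℕ) : Continuous fun X : Boundary N => X.1 i :=
  (continuous_apply i).comp isClosedEmbedding_val.continuous

/-- If all prefixes of `T` occur in the one-signed ray `P`, then by compactness `T` is a coordinate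
of a limit of shifts of `(P, Q)`; the other coordinate has a first letter of opposite sign. -/
theorem exists_mem_closure_orbit {ε : Bool} {P Q T : Boundary N} (hP : ∀ i, (P.1 i).2 = ε)
    (hQ : (Q.1 0).2 = !ε) (hT : ∀ m, ∃ j, ∀ i < m, P.1 (j + i) = T.1 i) :
    ∃ L, T ≠ L ∧ (T, L) ∈ closure (Set.range fun j => shiftInv^[j] (P, Q)) := by
  set O := Set.range fun j => shiftInv^[j] (P, Q) with hO
  choose j hj using hT
  have hlim : Tendsto (fun m => P.drop (j m)) atTop (𝓝 T) := (tendsto_boundary_iff _ _).2 fun i =>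
    eventually_atTop.2 ⟨i + 1, fun m hm => hj m i (by omega)⟩
  have hmem : T ∈ closure (Prod.fst '' O) :=
    mem_closure_of_tendsto hlim (Eventually.of_forall fun m =>
      ⟨_, ⟨j m, rfl⟩, (iterate_shiftInv hP hQ (j m)).1⟩)
  have hcl : IsClosed (Prod.fst '' closure O) :=
    (isClosed_closure.isCompact.image continuous_fst).isClosed
  obtain ⟨⟨T', L⟩, hW, rfl⟩ :=
    closure_minimal (Set.image_mono subset_closure) hcl hmem
  refine ⟨L, fun h => ?_, hW⟩
  have hsign : (L.1 0).2 = !ε := by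
    have hc : IsClosed {W : Boundary N × Boundary N | (W.2.1 0).2 = !ε} :=
      (isClosed_discrete {x : Fin N × Bool | x.2 = !ε}).preimage
        ((continuous_letter 0).comp continuous_snd)
    refine closure_minimal ?_ hc hW
    rintro _ ⟨n, rfl⟩
    exact (iterate_shiftInv hP hQ n).2
  have h1 := hj 1 0 one_pos
  simp only at h
  rw [← h, ← h1, hP] at hsign
  simp at hsign

theorem iterate_shift_eq (Z : Boundary N × Boundary N) (n : ℕ) :
    shift^[n] Z = (shiftInv^[n] Z.swap).swap := by
  induction n with
  | zero => rfl
  | succ n ih => rw [Function.iterate_succ_apply', Function.iterate_succ_apply', ih]; rfl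

/-- A generic ray contains every prefix of a legal ray of the same sign. -/
theorem IsGenericRay.exists_shift {φ : MulAut (FreeGroup (Fin N))} {ε : Bool} {P T : Boundary N}
    (hP : IsGenericRay φ ε P) (hT : IsLegalRay φ ε T) (m : ℕ) :
    ∃ j, ∀ i < m, P.1 (j + i) = T.1 i := by
  obtain ⟨M, p, s, h⟩ := hP.2 _ (hT m)
  rw [toWord_take, toWord_take] at h
  refine ⟨p.length, fun i hi => ?_⟩
  have h1 := congrArg (fun l => l[p.length + i]?) h
  simp only [List.append_assoc, List.getElem?_append_right (Nat.le_add_right _ _),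
    Nat.add_sub_cancel_left] at h1
  rw [List.getElem?_append_left (by simpa using hi)] at h1
  simp only [List.getElem?_map, List.getElem?_range hi, Option.map_some] at h1
  obtain ⟨c, hc, hc'⟩ := Option.map_eq_some_iff.1 h1.symm
  rw [List.getElem?_eq_some_iff] at hc
  obtain ⟨_, hc⟩ := hc
  rw [List.getElem_range] at hc
  rw [hc, hc']

theorem IsLegalRay.mem_halfLamination {φ : MulAut (FreeGroup (Fin N))} (hpos : IsPositive φ)
    (hprim : IsPrimitive φ) {A : Set (Boundary N × Boundary N)} (hA : IsAttractingSubshift φ A)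
    {ε : Bool} {T : Boundary N} (hT : IsLegalRay φ ε T) (v : FreeGroup (Fin N)) :
    v • T ∈ halfLamination A := by
  obtain ⟨Z, hZ, rfl⟩ := hA
  obtain ⟨h1, h2⟩ := hZ.isGenericRay hpos hprim
  refine ⟨v, T, ?_, rfl⟩
  cases ε with
  | false =>
    obtain ⟨L, hL, hmem⟩ := exists_mem_closure_orbit (Q := Z.2) (h1.1.sign hpos)
      (h2.1.sign hpos 0) (h1.exists_shift hT)
    refine Or.inl ⟨(T, L), ⟨closure_mono ?_ hmem, hL⟩, rfl⟩
    rintro _ ⟨n, rfl⟩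
    exact ⟨n, Or.inr rfl⟩
  | true =>
    obtain ⟨L, hL, hmem⟩ := exists_mem_closure_orbit (Q := Z.1) (h2.1.sign hpos)
      (h1.1.sign hpos 0) (h2.exists_shift hT)
    refine Or.inr ⟨(L, T), ⟨?_, hL.symm⟩, rfl⟩
    refine map_mem_closure (f := Prod.swap) continuous_swap hmem ?_
    rintro _ ⟨n, rfl⟩
    exact ⟨n, Or.inl (iterate_shift_eq Z n).symm⟩

/-- Two sequences of group elements at legal distance have the same limit outside the half
lamination: otherwise, beyond the branching point, the legal words between them run along a tail of
the limit, so that this tail is a legal ray. -/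
theorem tendsto_of_isLegal {φ : MulAut (FreeGroup (Fin N))} (hpos : IsPositive φ)
    (hprim : IsPrimitive φ) {A : Set (Boundary N × Boundary N)} (hA : IsAttractingSubshift φ A)
    {X : Boundary N} (hX : X ∉ halfLamination A) {u v : ℕ → FreeGroup (Fin N)}
    (hv : Tendsto (fun n => word (v n)) atTop (𝓝 (point X)))
    (huv : ∀ n, ∃ ε, IsLegal φ ε ((u n)⁻¹ * v n).toWord) :
    Tendsto (fun n => word (u n)) atTop (𝓝 (point X)) := by
  rw [tendsto_word_iff]
  by_contra! hcon
  obtain ⟨i, hi⟩ := hcon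
  have hlegal : ∀ m, ∃ ε, IsLegal φ ε ((X.drop i).take m).toWord := by
    intro m
    obtain ⟨n, hn, hpre⟩ :=
      (hi.and_eventually ((tendsto_word_iff_prefix v X).1 hv (i + 1 + m))).exists
    obtain ⟨ε, hε⟩ := huv n
    refine ⟨ε, hε.infix ?_⟩
    have hvi : (v n).toWord[i]? = some (X.1 i) := by
      rw [List.prefix_iff_getElem?] at hpre
      have hlen : i < ((List.range (i + 1 + m)).map X.1).length := by
        rw [List.length_map, List.length_range]; omega
      rw [hpre i hlen, List.getElem_map, List.getElem_range]
    have hsuf := drop_suffix_toWord_inv_mul i (u n).toWord (v n).toWord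
      FreeGroup.isReduced_toWord FreeGroup.isReduced_toWord
      (by intro x hx hx'; exact hn (by rw [hx, ← hx', hvi]))
    rw [FreeGroup.mk_toWord, FreeGroup.mk_toWord] at hsuf
    refine List.IsInfix.trans ?_ hsuf.isInfix
    obtain ⟨l, hl⟩ := hpre
    rw [← hl, toWord_take, add_assoc, List.range_add, List.map_append, List.append_assoc,
      List.drop_left' (by simp), List.map_map, add_comm 1 m, List.range_add, List.map_append,
      List.append_assoc]
    exact (List.prefix_append _ _).isInfix
  refine hX ?_
  rw [← take_smul_drop X i]
  refine IsLegalRay.mem_halfLamination (ε := (X.1 i).2) hpos hprim hA (fun m => ?_) _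
  obtain ⟨ε, hε⟩ := hlegal (m + 1)
  have hs : (X.1 i).2 = ε := by
    refine hε.hasSign hpos _ ?_
    rw [toWord_take]
    exact List.mem_map.2 ⟨0, by simp, rfl⟩
  rw [hs]
  refine hε.infix ?_
  rw [toWord_take, toWord_take, List.range_succ, List.map_append]
  exact (List.prefix_append _ _).isInfix

/-! ### Orbits of the automorphism followed by a translation -/

/-- `w⁻¹ φ(w⁻¹) ⋯ φⁿ⁻¹(w⁻¹)`, the image of the identity under the `n`-th iterate of the map
`u ↦ w⁻¹ φ(u)`. The image of `u` is `drift φ w n * (φ ^ n) u`. -/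
def drift (φ : MulAut (FreeGroup (Fin N))) (w : FreeGroup (Fin N)) (n : ℕ) : FreeGroup (Fin N) :=
  ((List.range n).map fun i => (φ ^ i) w⁻¹).prod

theorem drift_succ (φ : MulAut (FreeGroup (Fin N))) (w : FreeGroup (Fin N)) (n : ℕ) :
    drift φ w (n + 1) = drift φ w n * (φ ^ n) w⁻¹ := by
  rw [drift, List.range_succ, List.map_append, List.prod_append, drift]
  simp

theorem conjugacy_mul_pow_apply (φ : MulAut (FreeGroup (Fin N))) (w u : FreeGroup (Fin N)) (n : ℕ) :
    ((conjugacy w * φ) ^ n) u = drift φ w n * (φ ^ n) u * (drift φ w n)⁻¹ := by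
  induction n generalizing u with
  | zero => simp [drift]
  | succ n ih =>
    rw [pow_succ, MulAut.mul_apply, ih, drift_succ, pow_succ φ n]
    have e : (conjugacy w * φ) u = w⁻¹ * φ u * w := by simp [conjugacy]
    rw [e, map_mul, map_mul, map_inv, MulAut.mul_apply]
    group

theorem tendsto_drift_take (φ : MulAut (FreeGroup (Fin N))) (w : FreeGroup (Fin N)) (Y : Boundary N)
    (n : ℕ) : Tendsto (fun m => word (drift φ w n * (φ ^ n) (Y.take m))) atTop
      (𝓝 (point ((boundaryMap (conjugacy w * φ))^[n] Y))) := by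
  have h := tendsto_mul_const (tendsto_pow_map (conjugacy w * φ) Y n) (drift φ w n)
  simpa only [conjugacy_mul_pow_apply, inv_mul_cancel_right] using h

theorem exists_eq_drop_eq {X R : Boundary N} (j : ℕ)
    (h : (X.1 j).1 = (R.1 0).1 → (X.1 j).2 = (R.1 0).2) :
    ∃ Y : Boundary N, (∀ i ≤ j, Y.1 i = X.1 i) ∧ Y.drop (j + 1) = R := by
  refine ⟨⟨fun i => if i ≤ j then X.1 i else R.1 (i - (j + 1)), fun i => ?_⟩,
    fun i hi => if_pos hi, boundary_ext fun i => ?_⟩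
  · rcases lt_trichotomy i j with hi | rfl | hi
    · simp only [hi.le, Nat.succ_le_of_lt hi, if_true]
      exact X.2 i
    · simpa using h
    · have e : i + 1 - (j + 1) = i - (j + 1) + 1 := by omega
      have h1 : ¬ i ≤ j := by omega
      have h2 : ¬ i + 1 ≤ j := by omega
      simp only [h1, h2, if_false, e]
      exact R.2 _
  · have h1 : ¬ j + 1 + i ≤ j := by omega
    simp [Boundary.drop, h1]

/-- Near an attracting point `X` there is a boundary point that ends in a legal ray. Its orbit
converges to `X`, hence so do points `v n` on the images of this ray, which are at legal distance
from the images of the starting point `g` of the ray. -/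
theorem IsBoundaryAttracting.exists_isLegal {φ : MulAut (FreeGroup (Fin N))} (hpos : IsPositive φ)
    (hprim : IsPrimitive φ) {Z : Boundary N × Boundary N} (hZ : IsGeneratingPair φ Z) {k : ℕ}
    {w : FreeGroup (Fin N)} {X : Boundary N}
    (h : IsBoundaryAttracting (conjugacy w * φ ^ k) X) :
    ∃ (g : FreeGroup (Fin N)) (v : ℕ → FreeGroup (Fin N)),
      Tendsto (fun n => word (v n)) atTop (𝓝 (point X)) ∧
      ∀ n, ∃ ε, IsLegal φ ε ((drift (φ ^ k) w n * ((φ ^ k) ^ n) g)⁻¹ * v n).toWord := by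
  obtain ⟨U, hU, h⟩ := h
  obtain ⟨j, hj⟩ := exists_cylinder_subset hU
  obtain ⟨hZ1, hZ2⟩ := hZ.isGenericRay hpos hprim
  -- The sign of the ray is that of the last letter before it, to avoid cancellation.
  obtain ⟨R, hR⟩ : ∃ R, IsLegalRay φ (X.1 j).2 R := by
    cases (X.1 j).2 with
    | false => exact ⟨_, hZ1.1⟩
    | true => exact ⟨_, hZ2.1⟩
  obtain ⟨Y, hYX, hYdrop⟩ := exists_eq_drop_eq (X := X) (R := R) j fun _ => (hR.sign hpos 0).symm
  have hYtake : Y.take (j + 1) = X.take (j + 1) := by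
    rw [Boundary.take, Boundary.take]
    congr 1
    refine List.map_congr_left fun i hi => hYX i ?_
    rw [List.mem_range] at hi; omega
  have hY := h Y (hj Y fun i hi => hYX i hi.le)
  have hm : ∀ n, ∃ m, ∀ i < n,
      (drift (φ ^ k) w n * ((φ ^ k) ^ n) (Y.take (m + (j + 1)))).toWord[i]? =
        some (((boundaryMap (conjugacy w * φ ^ k))^[n] Y).1 i) := by
    intro n
    have h1 := (tendsto_word_iff _ _).1
      ((tendsto_add_atTop_iff_nat (j + 1)).2 (tendsto_drift_take (φ ^ k) w Y n))
    obtain ⟨m, hm⟩ := ((Finset.range n).eventually_all.2 fun i _ => h1 i).exists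
    exact ⟨m, fun i hi => hm i (Finset.mem_range.2 hi)⟩
  choose m hm using hm
  refine ⟨X.take (j + 1), fun n => drift (φ ^ k) w n * ((φ ^ k) ^ n) (Y.take (m n + (j + 1))),
    ?_, fun n => ⟨(X.1 j).2, ?_⟩⟩
  · rw [tendsto_word_iff]
    intro i
    filter_upwards [(tendsto_boundary_iff _ _).1 hY i, eventually_gt_atTop i] with n h1 h2
    rw [hm n i h2, h1]
  · have e : (drift (φ ^ k) w n * ((φ ^ k) ^ n) (X.take (j + 1)))⁻¹ *
        (drift (φ ^ k) w n * ((φ ^ k) ^ n) (Y.take (m n + (j + 1)))) =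
        (φ ^ (k * n)) (R.take (m n)) := by
      rw [add_comm (m n), take_add Y, hYtake, hYdrop, map_mul, pow_mul]
      group
    rw [e]
    exact (hR (m n)).map_pow hpos _

/-- The orbit of every group element under `u ↦ w⁻¹ φᵏ(u)` converges to an attracting point
outside the half lamination: this property passes from `u` to its neighbours in the Cayley graph,
since the images of an edge are legal. -/
theorem IsBoundaryAttracting.tendsto_drift {φ : MulAut (FreeGroup (Fin N))} (hpos : IsPositive φ)
    (hprim : IsPrimitive φ) {A : Set (Boundary N × Boundary N)} (hA : IsAttractingSubshift φ A)
    {k : ℕ} {w : FreeGroup (Fin N)} {X : Boundary N} (hX : X ∉ halfLamination A)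
    (h : IsBoundaryAttracting (conjugacy w * φ ^ k) X) (u : FreeGroup (Fin N)) :
    Tendsto (fun n => word (drift (φ ^ k) w n * ((φ ^ k) ^ n) u)) atTop (𝓝 (point X)) := by
  have hA' := hA
  obtain ⟨Z, hZ, -⟩ := hA'
  obtain ⟨g, v, hv, hg⟩ := h.exists_isLegal hpos hprim hZ
  have hbase := tendsto_of_isLegal hpos hprim hA hX hv hg
  have key : ∀ l : List (Fin N × Bool), Tendsto (fun n => word (drift (φ ^ k) w n *
      ((φ ^ k) ^ n) (g * FreeGroup.mk l))) atTop (𝓝 (point X)) := by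
    intro l
    induction l using List.reverseRecOn with
    | nil => simpa [← FreeGroup.one_eq_mk] using hbase
    | append_singleton l x ih =>
      refine tendsto_of_isLegal hpos hprim hA hX ih fun n => ⟨!x.2, ?_⟩
      have e : (drift (φ ^ k) w n * ((φ ^ k) ^ n) (g * FreeGroup.mk (l ++ [x])))⁻¹ *
          (drift (φ ^ k) w n * ((φ ^ k) ^ n) (g * FreeGroup.mk l)) =
          ((φ ^ (k * n)) (FreeGroup.mk [x]))⁻¹ := by
        rw [← FreeGroup.mul_mk, pow_mul]
        simp only [map_mul]
        group
      rw [e]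
      exact (isLegal_pow_letter φ (k * n) x).inv
  simpa [FreeGroup.mk_toWord] using key (g⁻¹ * u).toWord

theorem IsBoundaryAttracting.eq_of_notMem_halfLamination {φ : MulAut (FreeGroup (Fin N))}
    (hpos : IsPositive φ) (hprim : IsPrimitive φ) {A : Set (Boundary N × Boundary N)}
    (hA : IsAttractingSubshift φ A) {k : ℕ} {w : FreeGroup (Fin N)} {X Y : Boundary N}
    (hX : X ∉ halfLamination A) (h : IsBoundaryAttracting (conjugacy w * φ ^ k) X)
    (hY : IsBoundaryAttracting (conjugacy w * φ ^ k) Y) : Y = X := by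
  have hA' := hA
  obtain ⟨Z, hZ, -⟩ := hA'
  obtain ⟨g, v, hv, hg⟩ := hY.exists_isLegal hpos hprim hZ
  refine tendsto_word_unique hv (tendsto_of_isLegal hpos hprim hA hX
    (h.tendsto_drift hpos hprim hA hX g) fun n => ?_)
  obtain ⟨ε, hε⟩ := hg n
  refine ⟨!ε, ?_⟩
  have := hε.inv
  rwa [mul_inv_rev, inv_inv] at this

/-- A fixed element `u` of `ψ` maps the limit `X` of the orbits to itself. If it were nontrivial,
then its powers, which `ψ` fixes, would accumulate at `X`, which therefore would not be
attracting. -/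
theorem IsAttracting.fixedSubgroup_eq_bot {φ : MulAut (FreeGroup (Fin N))} (hpos : IsPositive φ)
    (hprim : IsPrimitive φ) {A : Set (Boundary N × Boundary N)} (hA : IsAttractingSubshift φ A)
    {k : ℕ} {w : FreeGroup (Fin N)} {X : Boundary N} (hX : X ∉ halfLamination A)
    (h : IsAttracting (conjugacy w * φ ^ k) X) : fixedSubgroup (conjugacy w * φ ^ k) = ⊥ := by
  set ψ := conjugacy w * φ ^ k with hψ
  rw [Subgroup.eq_bot_iff_forall]
  intro u hu
  by_contra hu1
  have hfix : ∀ z ∈ fixedSubgroup ψ, ∀ n : ℕ, (ψ ^ n) z = z := by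
    intro z hz n
    induction n with
    | zero => rfl
    | succ n ih =>
      have hz' : ψ z = z := hz
      rw [pow_succ, MulAut.mul_apply, hz', ih]
  have hdrift := h.isBoundaryAttracting.tendsto_drift hpos hprim hA hX
  have hsmul : u • X = X := by
    have h1 : Tendsto (fun n => word (drift (φ ^ k) w n)) atTop (𝓝 (point X)) := by
      simpa only [map_one, mul_one] using hdrift 1
    refine tendsto_word_unique (tendsto_mul_left h1 u) ((hdrift u).congr fun n => ?_)
    have h2 := hfix u hu n
    rw [conjugacy_mul_pow_apply, mul_inv_eq_iff_eq_mul] at h2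
    rw [h2]
  obtain ⟨z, hz, hlim⟩ := exists_tendsto_pow_of_smul_eq hu1 hsmul
  have hzF : z ∈ fixedSubgroup ψ := by
    rcases hz with rfl | rfl
    · exact hu
    · exact inv_mem hu
  obtain ⟨U, hU, hatt⟩ := h
  obtain ⟨m, hm⟩ := (hlim.eventually hU).exists
  have h3 := hatt _ hm
  simp only [iterate_extendedMap_word, hfix _ (pow_mem hzF m)] at h3
  obtain ⟨n, hn⟩ := (eventually_le_norm h3 ((z ^ m).norm + 1)).exists
  omega

theorem subgroupRank_bot {G : Type*} [Group G] : subgroupRank (⊥ : Subgroup G) = 0 := by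
  rw [subgroupRank, ← nonpos_iff_eq_zero]
  exact (iInf_le _ ⟨∅, Subgroup.closure_empty⟩).trans (by simp)

end FreeBoundary

open FreeBoundary FreeBoundary.Compactification Filter Topology in
theorem mainTheorem7 (N : ℕ) (hN : 2 ≤ N) (φ : MulAut (FreeGroup (Fin N)))
    (hpos : IsPositive φ) (hprim : IsPrimitive φ)
    (A : Set (Boundary N × Boundary N)) (hA : IsAttractingSubshift φ A) :
    (∀ (w : FreeGroup (Fin N)) (X : Boundary N), X ∉ halfLamination A →
      IsBoundaryAttracting (conjugacy w * φ) X →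
      w ≠ 1 ∧ Tendsto (fun n => word (iterProd φ w⁻¹ n)) atTop (𝓝 (point X))) ∧
    (∀ ψ ∈ outerPowers φ, (∃ X, X ∉ halfLamination A ∧ IsAttracting ψ X) →
      index ψ = ((-1 / 2 : ℝ) : EReal)) := by
  constructor
  · intro w X hX h
    rw [← pow_one φ] at h
    have h1 := h.tendsto_drift hpos hprim hA hX 1
    simp only [map_one, mul_one, pow_one] at h1
    refine ⟨?_, (tendsto_add_atTop_iff_nat 1).2 h1⟩
    rintro rfl
    have hd : ∀ n, drift φ 1 n = 1 := by
      intro n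
      induction n with
      | zero => simp [drift]
      | succ n ih => rw [drift_succ, ih]; simp
    obtain ⟨n, hn⟩ := (eventually_le_norm h1 1).exists
    rw [hd, FreeGroup.norm_one] at hn
    omega
  · rintro ψ ⟨k, -, w, rfl⟩ ⟨X, hX, h⟩
    have hbot := h.fixedSubgroup_eq_bot hpos hprim hA hX
    have hnum : numAttracting (conjugacy w * φ ^ k) = 1 := by
      rw [numAttracting, Set.encard_eq_one]
      refine ⟨{X}, Set.eq_singleton_iff_unique_mem.2 ⟨⟨X, h, ?_⟩, ?_⟩⟩
      · ext Y
        simp [hbot, one_smul_boundary]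
      · rintro _ ⟨Y, hY, rfl⟩
        obtain rfl := h.isBoundaryAttracting.eq_of_notMem_halfLamination hpos hprim hA hX
          hY.isBoundaryAttracting
        ext Y
        simp [hbot, one_smul_boundary]
    rw [index, hnum, hbot, subgroupRank_bot]
    have e : (1 : EReal) - 2 = ((-1 : ℝ) : EReal) := by
      rw [show (1 : EReal) = ((1 : ℝ) : EReal) from rfl,
        show (2 : EReal) = ((2 : ℝ) : EReal) from rfl, ← EReal.coe_sub]
      norm_num
    simp only [ENat.toENNReal_zero, ENat.toENNReal_one, EReal.coe_ennreal_zero,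
      EReal.coe_ennreal_one, zero_add]
    rw [e, ← EReal.coe_mul]
    norm_num
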